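/- Fix integers $m,n\ge 0$ and sequences $\mathbf I=\{0=i_0<i_1<\dots<i_r=m\}$ and $\mathbf J=\{0=j_0<j_1<\dots<j_s=n\}$. Let $L_{\mathbf I}\le GL_m(\mathbb C)$ be the group of invertible block-diagonal matrices with block sizes $i_1-i_0,\dots,i_r-i_{r-1}$, define $L_{\mathbf J}\le GL_n(\mathbb C)$ likewise, and let $\mathbf L_{\mathbf I|\mathbf J}=L_{\mathbf I}\times L_{\mathbf J}$ act on the space $\mathsf{Mat}_{m,n}$ of complex $m\times n$ matrices by $(p,q)\cdot M=p^{-1}M(q^{-1})^T$. Put $S=\mathbb C[z_{ij}]_{1\le i\le m,\,1\le j\le n}$. For a (possibly reducible) closed subvariety $\mathfrak X\subseteq\mathsf{Mat}_{m,n}$ with vanishing ideal $I(\mathfrak X)$ and a term order $<$, let $\mathsf{Std}_<(S/I(\mathfrak X))$ be the set of monomials (with coefficient $1$) outside the initial ideal of $I(\mathfrak X)$, each identified with its exponent matrix in $\mathsf{Mat}_{m,n}(\mathbb Z_{\ge0})$. For $M\in\mathsf{Mat}_{m,n}(\mathbb Z_{\ge 0})$ the row word $\mathsf{row}(M)$ records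 $m_{ij}$ copies of the letter $i$ for each entry $m_{ij}$, read along columns top to bottom, columns from left to right; the column word $\mathsf{col}(M)$ records $m_{ij}$ copies of $j$, read along rows left to right, rows from top to bottom. For $1\le i<m$ replace each letter $i+1$ of $\mathsf{row}(M)$ by "(" and each letter $i$ by ")" and match parentheses. If the leftmost unmatched "(" comes from the entry $(i+1,b)$, then $e_i^{\mathsf{row}}(M)$ is obtained from $M$ by subtracting $1$ from $m_{i+1,b}$ and adding $1$ to $m_{i,b}$; if the rightmost unmatched ")" comes from the entry $(i,a)$, then $f_i^{\mathsf{row}}(M)$ is obtained by subtracting $1$ from $m_{i,a}$ and adding $1$ to $m_{i+1,a}$; without such a parenthesis the value is $\varnothing$. The operators $e_j^{\mathsf{col}},f_j^{\mathsf{col}}$ ($1\le j<n$) are defined in the same way from $\mathsf{col}(M)$, that is, by transposing. The variety $\mathfrak X$ is $\mathbf L_{\mathbf I|\mathbf J}$-bicrystalline, as witnessed by $<$, if it is $\mathbf L_{\mathbf I|\mathbf J}$-stable and for all $\mathsf m\in\mathsf{Std}_<(S/I(\mathfrak X))$, $i\notin\mathbf I$, $j\notin\mathbf J$ the values $e_i^{\mathsf{row}}(\mathsf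 m),f_i^{\mathsf{row}}(\mathsf m),e_j^{\mathsf{col}}(\mathsf m),f_j^{\mathsf{col}}(\mathsf m)$ lie in $\mathsf{Std}_<(S/I(\mathfrak X))\cup\{\varnothing\}$. Let $\mathsf{filterRSK}_{\mathbf I|\mathbf J}(M)=(P^{(1)},\dots,P^{(r)}\,|\,Q^{(1)},\dots,Q^{(s)})$, where $P^{(a)}$ (respectively $Q^{(b)}$) is the unique semistandard Young tableau whose column reading word is Knuth equivalent to the subword of $\mathsf{row}(M)$ formed by the letters in $[i_{a-1}+1,i_a]$ (respectively the subword of $\mathsf{col}(M)$ formed by the letters in $[j_{b-1}+1,j_b]$). Let $\underline\lambda=(\lambda^{(1)},\dots,\lambda^{(r)})$ and $\underline\mu=(\mu^{(1)},\dots,\mu^{(s)})$ be tuples of partitions such that $\lambda^{(a)}$ has at most $i_a-i_{a-1}$ rows and $\mu^{(b)}$ has at most $j_b-j_{b-1}$ rows. Let $T_{\underline\lambda}$ be the tuple whose $a$-th component is the tableau of shape $\lambda^{(a)}$ with all entries of its $t$-th row equal to $i_{a-1}+t$, define $T_{\underline\mu}$ likewise, and for $\mathfrak X$ bicrystalline as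 witnessed by $<$ let $$c^{\mathfrak X}_{\underline\lambda|\underline\mu}=\#\{\mathsf m\in\mathsf{Std}_<(S/I(\mathfrak X)) : \mathsf{filterRSK}_{\mathbf I|\mathbf J}(\mathsf m)=(T_{\underline\lambda}|T_{\underline\mu})\}.$$ Write $\underline\lambda$ as the sequence $(\lambda_1,\dots,\lambda_m)$ obtained by padding each $\lambda^{(a)}$ with zeros to $i_a-i_{a-1}$ parts and concatenating, and similarly $\underline\mu$ as $(\mu_1,\dots,\mu_n)$. Let $\mathcal P_{\underline\lambda|\underline\mu}\subset\mathsf{Mat}_{m,n}(\mathbb R)$ be the polytope of all $M=[m_{i,j}]$ with (setting $m_{i,j}=0$ if $i>m$ or $j>n$) $$\sum_{k=j}^n m_{i+1,k}\le\sum_{k=j}^n m_{i,k+1}\quad (i\in[m]\setminus\mathbf I,\ j\in[n]),\qquad \sum_{k=i}^m m_{k,j+1}\le\sum_{k=i}^m m_{k+1,j}\quad (j\in[n]\setminus\mathbf J,\ i\in[m]),$$ $$\sum_{j=1}^n m_{i,j}=\lambda_i\ (i\in[m]),\qquad \sum_{i=1}^m m_{i,j}=\mu_j\ (j\in[n]),\qquad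 m_{i,j}\ge0,$$ and let $\mathcal P^{\mathfrak X}\subset\mathsf{Mat}_{m,n}(\mathbb Z_{\ge0})$ be the set of lattice points corresponding to the elements of $\mathsf{Std}_<(S/I(\mathfrak X))$. Then, for every $\mathbf L_{\mathbf I|\mathbf J}$-bicrystalline $\mathfrak X\subseteq\mathsf{Mat}_{m,n}$, every term order $<$ witnessing this, and all $(\underline\lambda|\underline\mu)$ as above, the set $\mathcal P^{\mathfrak X}\cap\mathcal P_{\underline\lambda|\underline\mu}$ is finite and $$c^{\mathfrak X}_{\underline\lambda|\underline\mu}=\#\bigl(\mathcal P^{\mathfrak X}\cap\mathcal P_{\underline\lambda|\underline\mu}\bigr).$$ -/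

import Mathlib

/-!
Conventions.  Rows and columns of `m × n` matrices are indexed by `Fin m` and `Fin n`; the letter
attached to a row or column index `i` in a word is `i + 1`, so that letters are `1, 2, …` as usual.
A sequence `0 = i_0 < i_1 < … < i_r = m` is a function `I : Fin (r + 1) → ℕ` with `IsCutSeq I m`.
-/

namespace FilteredRSK

/-- `I` is a sequence `0 = i_0 < i_1 < … < i_r = m`. -/
structure IsCutSeq {r : ℕ} (I : Fin (r + 1) → ℕ) (m : ℕ) : Prop where
  strictMono : StrictMono I
  zero : I 0 = 0
  last : I (Fin.last r) = m

/-! ### Words of a matrix, bracketing and bicrystal operators -/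

section Words

variable {m n : ℕ}

/-- The cells of `M`, each repeated as often as its entry says, read along columns top to bottom,
columns from left to right. -/
def rowCells (M : Matrix (Fin m) (Fin n) ℕ) : List (Fin m × Fin n) :=
  (List.finRange n).flatMap fun j =>
    (List.finRange m).flatMap fun i => List.replicate (M i j) (i, j)

/-- The cells of `M`, each repeated as often as its entry says, read across rows left to right,
rows from top to bottom. -/
def colCells (M : Matrix (Fin m) (Fin n) ℕ) : List (Fin m × Fin n) :=
  (List.finRange m).flatMap fun i =>
    (List.finRange n).flatMap fun j => List.replicate (M i j) (i, j)

/-- The row word of `M`. -/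
def rowWord (M : Matrix (Fin m) (Fin n) ℕ) : List ℕ :=
  (rowCells M).map fun c => c.1.val + 1

/-- The column word of `M`. -/
def colWord (M : Matrix (Fin m) (Fin n) ℕ) : List ℕ :=
  (colCells M).map fun c => c.2.val + 1

/-- One step of left-to-right parenthesis matching.  The state is the pair consisting of the list of
unmatched closing brackets and the stack of currently unmatched opening brackets, both with the most
recent one first.  A closing bracket is matched with the top of the stack, if there is one. -/
def bracketStep {α : Type*} (isOpen isClose : α → Bool) (st : List α × List α) (x : α) :
    List α × List α :=
  if isOpen x then (st.1, x :: st.2)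
  else if isClose x then
    match st.2 with
    | [] => (x :: st.1, [])
    | _ :: rest => (st.1, rest)
  else st

/-- The unmatched closing brackets and the unmatched opening brackets of a list,
each listed from right to left. -/
def unmatched {α : Type*} (isOpen isClose : α → Bool) (w : List α) : List α × List α :=
  w.foldl (bracketStep isOpen isClose) ([], [])

/-- Bracketing of the row word with respect to the row indices `lo` and `hi = lo + 1`: the letter of
row `hi` is "(", the letter of row `lo` is ")".  The cells giving the unmatched brackets are
returned. -/
def rowUnmatched (lo hi : Fin m) (M : Matrix (Fin m) (Fin n) ℕ) :
    List (Fin m × Fin n) × List (Fin m × Fin n) :=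
  unmatched (fun c => decide (c.1 = hi)) (fun c => decide (c.1 = lo)) (rowCells M)

/-- Bracketing of the column word with respect to the column indices `lo` and `hi = lo + 1`. -/
def colUnmatched (lo hi : Fin n) (M : Matrix (Fin m) (Fin n) ℕ) :
    List (Fin m × Fin n) × List (Fin m × Fin n) :=
  unmatched (fun c => decide (c.2 = hi)) (fun c => decide (c.2 = lo)) (colCells M)

/-- Row raising operator: with `(hi, b)` the cell of the leftmost unmatched "(" in the row word,
subtract one from the entry `(hi, b)` and add one to the entry `(lo, b)`; `none` plays the role
of `∅`. -/
def eRow (lo hi : Fin m) (M : Matrix (Fin m) (Fin n) ℕ) : Option (Matrix (Fin m) (Fin n) ℕ) :=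
  (rowUnmatched lo hi M).2.getLast?.map fun c =>
    M - Matrix.single hi c.2 1 + Matrix.single lo c.2 1

/-- Row lowering operator: uses the cell `(lo, a)` of the rightmost unmatched ")". -/
def fRow (lo hi : Fin m) (M : Matrix (Fin m) (Fin n) ℕ) : Option (Matrix (Fin m) (Fin n) ℕ) :=
  (rowUnmatched lo hi M).1.head?.map fun c =>
    M - Matrix.single lo c.2 1 + Matrix.single hi c.2 1

/-- Column raising operator. -/
def eCol (lo hi : Fin n) (M : Matrix (Fin m) (Fin n) ℕ) : Option (Matrix (Fin m) (Fin n) ℕ) :=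
  (colUnmatched lo hi M).2.getLast?.map fun c =>
    M - Matrix.single c.1 hi 1 + Matrix.single c.1 lo 1

/-- Column lowering operator. -/
def fCol (lo hi : Fin n) (M : Matrix (Fin m) (Fin n) ℕ) : Option (Matrix (Fin m) (Fin n) ℕ) :=
  (colUnmatched lo hi M).1.head?.map fun c =>
    M - Matrix.single c.1 lo 1 + Matrix.single c.1 hi 1

end Words

/-! ### Tableaux, Knuth equivalence and filtered RSK -/

section Tableaux

/-- The column reading word: columns from left to right, each read bottom to top. -/
def readingWord {μ : YoungDiagram} (T : SemistandardYoungTableau μ) : List ℕ :=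
  (List.range (μ.rowLen 0)).flatMap fun j =>
    (List.range (μ.colLen j)).reverse.map fun i => T i j

/-- Elementary Knuth moves, performed on consecutive letters of a word. -/
inductive KnuthMove : List ℕ → List ℕ → Prop
  | left (u v : List ℕ) (x y z : ℕ) (hxy : x < y) (hyz : y ≤ z) :
      KnuthMove (u ++ [y, z, x] ++ v) (u ++ [y, x, z] ++ v)
  | right (u v : List ℕ) (x y z : ℕ) (hxy : x ≤ y) (hyz : y < z) :
      KnuthMove (u ++ [z, x, y] ++ v) (u ++ [x, z, y] ++ v)

/-- Knuth equivalence: the equivalence relation generated by the elementary Knuth moves. -/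
def KnuthEquiv : List ℕ → List ℕ → Prop := Relation.EqvGen KnuthMove

/-- Semistandard tableaux of arbitrary shape. -/
abbrev Tableau : Type := Σ μ : YoungDiagram, SemistandardYoungTableau μ

open Classical in
/-- The semistandard tableau whose reading word is Knuth equivalent to `w`.  It exists and is unique
for every word; the value in the second branch is never taken.  Knuth moves preserve the letters, so
the entries of the tableau are letters of `w`. -/
noncomputable def knuthTableau (w : List ℕ) : Tableau :=
  if h : ∃ T : Tableau, KnuthEquiv w (readingWord T.2) then h.choose else ⟨⊥, default⟩

/-- The `k`-th component of the `I`-filtration of `w`: the subword of the letters in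
`[i_{k-1} + 1, i_k]`. -/
def filterWord {r : ℕ} (I : Fin (r + 1) → ℕ) (w : List ℕ) (k : Fin r) : List ℕ :=
  w.filter fun a => decide (I k.castSucc + 1 ≤ a ∧ a ≤ I k.succ)

/-- Filtered RSK. -/
noncomputable def filterRSK {m n r s : ℕ} (I : Fin (r + 1) → ℕ) (J : Fin (s + 1) → ℕ)
    (M : Matrix (Fin m) (Fin n) ℕ) : (Fin r → Tableau) × (Fin s → Tableau) :=
  (fun k => knuthTableau (filterWord I (rowWord M) k),
   fun k => knuthTableau (filterWord J (colWord M) k))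

/-- The highest-weight tableau of shape `μ` with smallest letter `a`: its entries in the `i`-th row
(`i = 1, 2, …`) are all equal to `a - 1 + i`. -/
def highestWeightTableau (μ : YoungDiagram) (a : ℕ) : SemistandardYoungTableau μ where
  entry i j := if (i, j) ∈ μ then a + i else 0
  row_weak' hj hcell := by
    rw [if_pos hcell, if_pos (μ.up_left_mem (by rfl) (le_of_lt hj) hcell)]
  col_strict' hi hcell := by
    rw [if_pos hcell, if_pos (μ.up_left_mem (le_of_lt hi) (by rfl) hcell)]
    omega
  zeros' not_cell := if_neg not_cell

/-- An `I`-filtered partition-tuple: the `k`-th partition has at most `i_k - i_{k-1}` rows. -/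
def IsFilteredTuple {r : ℕ} (I : Fin (r + 1) → ℕ) (lam : Fin r → YoungDiagram) : Prop :=
  ∀ k : Fin r, (lam k).colLen 0 ≤ I k.succ - I k.castSucc

/-- The highest-weight tableau-tuple of shape `lam`. -/
def highestWeightTuple {r : ℕ} (I : Fin (r + 1) → ℕ) (lam : Fin r → YoungDiagram) :
    Fin r → Tableau :=
  fun k => ⟨lam k, highestWeightTableau (lam k) (I k.castSucc + 1)⟩

/-- The filtered partition-tuple `lam` as a sequence `(λ_1, …, λ_m)`: the parts of the partitions
(with zeros appended) are concatenated.  Here `i` is the index starting from `0`, and exactly one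
summand has `i_{k-1} ≤ i < i_k`. -/
def flatParts {r : ℕ} (I : Fin (r + 1) → ℕ) (lam : Fin r → YoungDiagram) (i : ℕ) : ℕ :=
  ∑ k : Fin r,
    if I k.castSucc ≤ i ∧ i < I k.succ then (lam k).rowLen (i - I k.castSucc) else 0

end Tableaux

/-! ### Varieties of matrices, Levi groups, standard monomials -/

section Varieties

variable {m n r s : ℕ}

/-- The exponent vector of the monomial `∏ z_{ij} ^ A_{ij}`. -/
noncomputable def exponent (A : Matrix (Fin m) (Fin n) ℕ) : (Fin m × Fin n) →₀ ℕ :=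
  Finsupp.equivFunOnFinite.symm fun p => A p.1 p.2

/-- A point of matrix space as a point of affine space with coordinates `z_{ij}`. -/
def coords (M : Matrix (Fin m) (Fin n) ℂ) : Fin m × Fin n → ℂ := fun p => M p.1 p.2

/-- `X` is a (possibly reducible) closed subvariety of matrix space. -/
def IsVariety (X : Set (Matrix (Fin m) (Fin n) ℂ)) : Prop :=
  ∃ E : Set (MvPolynomial (Fin m × Fin n) ℂ),
    X = {M | ∀ p ∈ E, MvPolynomial.eval (coords M) p = 0}

/-- The ideal `I(X)` of polynomials vanishing on `X`. -/
noncomputable def idealOf (X : Set (Matrix (Fin m) (Fin n) ℂ)) : Ideal (MvPolynomial (Fin m × Fin n) ℂ) :=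
  MvPolynomial.vanishingIdeal ℂ (coords '' X)

/-- The initial ideal of an ideal with respect to a term order. -/
noncomputable def initialIdeal (ord : MonomialOrder (Fin m × Fin n))
    (K : Ideal (MvPolynomial (Fin m × Fin n) ℂ)) : Ideal (MvPolynomial (Fin m × Fin n) ℂ) :=
  Ideal.span {g | ∃ f ∈ K, g = ord.leadingTerm f}

/-- The standard monomials of `S / I(X)`, identified with their exponent matrices. -/
def stdMonomials (ord : MonomialOrder (Fin m × Fin n)) (X : Set (Matrix (Fin m) (Fin n) ℂ)) :
    Set (Matrix (Fin m) (Fin n) ℕ) :=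
  {A | MvPolynomial.monomial (exponent A) (1 : ℂ) ∉ initialIdeal ord (idealOf X)}

/-- `p` lies in the Levi subgroup `GL_{i_1 - i_0} × ⋯ × GL_{i_r - i_{r-1}}` of block-diagonal
matrices: an entry can be nonzero only if its row and column index lie in the same block. -/
def MemLevi (I : Fin (r + 1) → ℕ) (p : GL (Fin m) ℂ) : Prop :=
  ∀ a b : Fin m, (p : Matrix (Fin m) (Fin m) ℂ) a b ≠ 0 →
    ∀ k : Fin (r + 1), a.val < I k ↔ b.val < I k

/-- `X` is stable under the action `(p, q) · M = p⁻¹ M (q⁻¹)ᵀ` of `L_I × L_J`. -/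
def IsLeviStable (I : Fin (r + 1) → ℕ) (J : Fin (s + 1) → ℕ)
    (X : Set (Matrix (Fin m) (Fin n) ℂ)) : Prop :=
  ∀ (p : GL (Fin m) ℂ) (q : GL (Fin n) ℂ), MemLevi I p → MemLevi J q → ∀ M ∈ X,
    ((p⁻¹ : GL (Fin m) ℂ) : Matrix (Fin m) (Fin m) ℂ) * M *
      ((q⁻¹ : GL (Fin n) ℂ) : Matrix (Fin n) (Fin n) ℂ).transpose ∈ X

/-- The standard monomials of `X` with respect to `ord` are closed under the row operators with
label `i ∉ I` and the column operators with label `j ∉ J` (where `∅` is allowed as an output).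
The operators with label `i` involve the rows `i` and `i + 1`; with indices starting from `0` these
are `lo = i - 1` and `hi = i`, so the label is the value of `hi`. -/
structure BicrystalClosedWith (I : Fin (r + 1) → ℕ) (J : Fin (s + 1) → ℕ)
    (ord : MonomialOrder (Fin m × Fin n)) (X : Set (Matrix (Fin m) (Fin n) ℂ)) : Prop where
  eRow_mem : ∀ lo hi : Fin m, hi.val = lo.val + 1 → hi.val ∉ Set.range I →
    ∀ A ∈ stdMonomials ord X, ∀ B, eRow lo hi A = some B → B ∈ stdMonomials ord X
  fRow_mem : ∀ lo hi : Fin m, hi.val = lo.val + 1 → hi.val ∉ Set.range I →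
    ∀ A ∈ stdMonomials ord X, ∀ B, fRow lo hi A = some B → B ∈ stdMonomials ord X
  eCol_mem : ∀ lo hi : Fin n, hi.val = lo.val + 1 → hi.val ∉ Set.range J →
    ∀ A ∈ stdMonomials ord X, ∀ B, eCol lo hi A = some B → B ∈ stdMonomials ord X
  fCol_mem : ∀ lo hi : Fin n, hi.val = lo.val + 1 → hi.val ∉ Set.range J →
    ∀ A ∈ stdMonomials ord X, ∀ B, fCol lo hi A = some B → B ∈ stdMonomials ord X

/-- `X` is an `L_{I|J}`-bicrystalline variety, as witnessed by the term order `ord`. -/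
structure IsBicrystallineWith (I : Fin (r + 1) → ℕ) (J : Fin (s + 1) → ℕ)
    (ord : MonomialOrder (Fin m × Fin n)) (X : Set (Matrix (Fin m) (Fin n) ℂ)) : Prop where
  isVariety : IsVariety X
  stable : IsLeviStable I J X
  closed : BicrystalClosedWith I J ord X

/-- The standard monomials that filtered RSK sends to the highest-weight tableau-tuple of
shape `(lam | mu)`. -/
def highestWeightStd (I : Fin (r + 1) → ℕ) (J : Fin (s + 1) → ℕ)
    (ord : MonomialOrder (Fin m × Fin n)) (X : Set (Matrix (Fin m) (Fin n) ℂ))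
    (lam : Fin r → YoungDiagram) (mu : Fin s → YoungDiagram) : Set (Matrix (Fin m) (Fin n) ℕ) :=
  {A | A ∈ stdMonomials ord X ∧
    filterRSK I J A = (highestWeightTuple I lam, highestWeightTuple J mu)}

/-- The coefficient `c^X_{lam | mu}`. -/
noncomputable def coefficient (I : Fin (r + 1) → ℕ) (J : Fin (s + 1) → ℕ)
    (ord : MonomialOrder (Fin m × Fin n)) (X : Set (Matrix (Fin m) (Fin n) ℂ))
    (lam : Fin r → YoungDiagram) (mu : Fin s → YoungDiagram) : ℕ :=
  (highestWeightStd I J ord X lam mu).ncard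

end Varieties

/-! ### The polytope -/

section Polytope

variable {m n r s : ℕ}

/-- The entry `m_{i,j}` with indices `i, j = 1, 2, …`, set to `0` outside the matrix. -/
def entry (M : Matrix (Fin m) (Fin n) ℝ) (i j : ℕ) : ℝ :=
  if h : (1 ≤ i ∧ i ≤ m) ∧ (1 ≤ j ∧ j ≤ n) then
    M ⟨i - 1, by omega⟩ ⟨j - 1, by omega⟩
  else 0

/-- The polytope cut out by the highest-weight conditions, the shape conditions and the
nonnegativity constraints. -/
structure MemPolytope (I : Fin (r + 1) → ℕ) (J : Fin (s + 1) → ℕ)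
    (lam : Fin r → YoungDiagram) (mu : Fin s → YoungDiagram)
    (M : Matrix (Fin m) (Fin n) ℝ) : Prop where
  row_highest : ∀ i ∈ Finset.Icc 1 m, i ∉ Set.range I → ∀ j ∈ Finset.Icc 1 n,
    ∑ k ∈ Finset.Icc j n, entry M (i + 1) k ≤ ∑ k ∈ Finset.Icc j n, entry M i (k + 1)
  col_highest : ∀ j ∈ Finset.Icc 1 n, j ∉ Set.range J → ∀ i ∈ Finset.Icc 1 m,
    ∑ k ∈ Finset.Icc i m, entry M k (j + 1) ≤ ∑ k ∈ Finset.Icc i m, entry M (k + 1) j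
  row_sum : ∀ i : Fin m, ∑ j, M i j = (flatParts I lam i.val : ℝ)
  col_sum : ∀ j : Fin n, ∑ i, M i j = (flatParts J mu j.val : ℝ)
  nonneg : ∀ i j, 0 ≤ M i j

/-- The polytope `P_{lam | mu}`. -/
def polytope (m n : ℕ) (I : Fin (r + 1) → ℕ) (J : Fin (s + 1) → ℕ)
    (lam : Fin r → YoungDiagram) (mu : Fin s → YoungDiagram) : Set (Matrix (Fin m) (Fin n) ℝ) :=
  {M | MemPolytope I J lam mu M}

/-- The set `P^X` of lattice points corresponding to the standard monomials of `X`. -/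
def stdLatticePoints (ord : MonomialOrder (Fin m × Fin n)) (X : Set (Matrix (Fin m) (Fin n) ℂ)) :
    Set (Matrix (Fin m) (Fin n) ℝ) :=
  (fun A : Matrix (Fin m) (Fin n) ℕ => A.map (fun a => (a : ℝ))) '' stdMonomials ord X

end Polytope

end FilteredRSK

namespace FilteredRSK

/-! ### Knuth equivalence and reverse lattice words -/

/-- In every suffix of `w` the letter `x + 1` occurs at most as often as the letter `x`. -/
def IsReverseLattice (x : ℕ) (w : List ℕ) : Prop :=
  ∀ v, v <:+ w → v.count (x + 1) ≤ v.count x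

theorem isReverseLattice_nil (x : ℕ) : IsReverseLattice x [] := by
  intro v hv
  simp [List.suffix_nil.1 hv]

theorem isReverseLattice_cons {x a : ℕ} {w : List ℕ} :
    IsReverseLattice x (a :: w) ↔
      (a :: w).count (x + 1) ≤ (a :: w).count x ∧ IsReverseLattice x w := by
  constructor
  · intro h
    exact ⟨h _ List.suffix_rfl, fun v hv => h v (hv.trans (List.suffix_cons a w))⟩
  · rintro ⟨h1, h2⟩ v hv
    rcases List.suffix_cons_iff.1 hv with rfl | hv
    exacts [h1, h2 v hv]

theorem IsReverseLattice.count_le {x : ℕ} {w : List ℕ} (h : IsReverseLattice x w) :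
    w.count (x + 1) ≤ w.count x :=
  h w List.suffix_rfl

theorem IsReverseLattice.of_append {x : ℕ} {u v : List ℕ} (h : IsReverseLattice x (u ++ v)) :
    IsReverseLattice x v :=
  fun v' hv => h v' (hv.trans (List.suffix_append u v))

theorem IsReverseLattice.append {x : ℕ} {u v : List ℕ} (hu : IsReverseLattice x u)
    (hv : IsReverseLattice x v) : IsReverseLattice x (u ++ v) := by
  induction u with
  | nil => exact hv
  | cons a u ih =>
    rw [isReverseLattice_cons] at hu
    rw [List.cons_append, isReverseLattice_cons]
    refine ⟨?_, ih hu.2⟩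
    have h1 := hu.1
    have h2 := hv.count_le
    rw [← List.cons_append, List.count_append, List.count_append]
    omega

theorem isReverseLattice_append_congr {x : ℕ} (u : List ℕ) {v v' : List ℕ} (hp : v.Perm v')
    (h : IsReverseLattice x v ↔ IsReverseLattice x v') :
    IsReverseLattice x (u ++ v) ↔ IsReverseLattice x (u ++ v') := by
  induction u with
  | nil => exact h
  | cons a u ih =>
    rw [List.cons_append, List.cons_append, isReverseLattice_cons, isReverseLattice_cons, ih,
      ((hp.append_left u).cons a).count_eq, ((hp.append_left u).cons a).count_eq]

theorem KnuthMove.perm {w w' : List ℕ} (h : KnuthMove w w') : w.Perm w' := by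
  cases h with
  | left u v x y z _ _ =>
    exact (((List.Perm.swap x z []).cons y).append_left u).append_right v
  | right u v x y z _ _ =>
    exact ((List.Perm.swap x z [y]).append_left u).append_right v

theorem KnuthMove.isReverseLattice_iff {w w' : List ℕ} (h : KnuthMove w w') (i : ℕ) :
    IsReverseLattice i w ↔ IsReverseLattice i w' := by
  cases h with
  | left u v x y z hxy hyz =>
    rw [List.append_assoc, List.append_assoc]
    refine isReverseLattice_append_congr u
      (((List.Perm.swap x z []).cons y).append_right v) ?_
    simp only [List.cons_append, List.nil_append, isReverseLattice_cons, List.count_cons,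
      beq_iff_eq]
    split_ifs <;> first | omega | (constructor <;> rintro ⟨h1, h2, h3, h4⟩ <;>
      have := h4.count_le <;> refine ⟨?_, ?_, ?_, h4⟩ <;> omega)
  | right u v x y z hxy hyz =>
    rw [List.append_assoc, List.append_assoc]
    refine isReverseLattice_append_congr u
      ((List.Perm.swap x z [y]).append_right v) ?_
    simp only [List.cons_append, List.nil_append, isReverseLattice_cons, List.count_cons,
      beq_iff_eq]
    split_ifs <;> first | omega | (constructor <;> rintro ⟨h1, h2, h3, h4⟩ <;>
      have := h4.count_le <;> refine ⟨?_, ?_, ?_, h4⟩ <;> omega)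

theorem KnuthMove.append {w w' : List ℕ} (h : KnuthMove w w') (s t : List ℕ) :
    KnuthMove (s ++ w ++ t) (s ++ w' ++ t) := by
  cases h with
  | left u v x y z hxy hyz =>
    simpa only [List.append_assoc] using KnuthMove.left (s ++ u) (v ++ t) x y z hxy hyz
  | right u v x y z hxy hyz =>
    simpa only [List.append_assoc] using KnuthMove.right (s ++ u) (v ++ t) x y z hxy hyz

theorem KnuthEquiv.refl (w : List ℕ) : KnuthEquiv w w := Relation.EqvGen.refl w

theorem KnuthEquiv.trans {w w' w'' : List ℕ} (h : KnuthEquiv w w') (h' : KnuthEquiv w' w'') :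
    KnuthEquiv w w'' :=
  Relation.EqvGen.trans _ _ _ h h'

theorem KnuthEquiv.perm {w w' : List ℕ} (h : KnuthEquiv w w') : w.Perm w' := by
  induction h with
  | rel _ _ h => exact h.perm
  | refl _ => exact List.Perm.refl _
  | symm _ _ _ ih => exact ih.symm
  | trans _ _ _ _ _ ih ih' => exact ih.trans ih'

theorem KnuthEquiv.isReverseLattice_iff {w w' : List ℕ} (h : KnuthEquiv w w') (i : ℕ) :
    IsReverseLattice i w ↔ IsReverseLattice i w' := by
  induction h with
  | rel _ _ h => exact h.isReverseLattice_iff i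
  | refl _ => exact Iff.rfl
  | symm _ _ _ ih => exact ih.symm
  | trans _ _ _ _ _ ih ih' => exact ih.trans ih'

theorem KnuthEquiv.append {w w' : List ℕ} (h : KnuthEquiv w w') (s t : List ℕ) :
    KnuthEquiv (s ++ w ++ t) (s ++ w' ++ t) := by
  induction h with
  | rel _ _ h => exact Relation.EqvGen.rel _ _ (h.append s t)
  | refl _ => exact KnuthEquiv.refl _
  | symm _ _ _ ih => exact ih.symm
  | trans _ _ _ _ _ ih ih' => exact ih.trans ih'

theorem KnuthEquiv.append_left {w w' : List ℕ} (h : KnuthEquiv w w') (s : List ℕ) :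
    KnuthEquiv (s ++ w) (s ++ w') := by
  simpa using h.append s []

theorem KnuthEquiv.append_right {w w' : List ℕ} (h : KnuthEquiv w w') (t : List ℕ) :
    KnuthEquiv (w ++ t) (w' ++ t) := by
  simpa using h.append [] t

/-! ### Column insertion -/

/-- The column with entries `C` may be placed to the left of the column with entries `D`:
for every `t`, it has at least as many entries that are at most `t`. -/
def Dominates (C D : List ℕ) : Prop :=
  ∀ t, D.countP (· ≤ t) ≤ C.countP (· ≤ t)

theorem Dominates.trans {C D E : List ℕ} (h : Dominates C D) (h' : Dominates D E) :
    Dominates C E :=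
  fun t => (h' t).trans (h t)

theorem Dominates.countP_lt_le {C D : List ℕ} (h : Dominates C D) (t : ℕ) :
    D.countP (· < t) ≤ C.countP (· < t) := by
  cases t with
  | zero => simp
  | succ t => simpa only [Nat.lt_succ_iff] using h t

theorem countP_le_eq_length_of_forall_lt {v : List ℕ} {x t : ℕ} (hv : ∀ a ∈ v, a < x)
    (hxt : x ≤ t) : v.countP (· ≤ t) = v.length :=
  List.countP_eq_length.2 fun a ha => by simpa using (hv a ha).le.trans hxt

theorem countP_lt_eq_length_of_forall_lt {v : List ℕ} {x t : ℕ} (hv : ∀ a ∈ v, a < x)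
    (hxt : x ≤ t) : v.countP (· < t) = v.length :=
  List.countP_eq_length.2 fun a ha => by simpa using (hv a ha).trans_le hxt

theorem Dominates.length_le {C D : List ℕ} (h : Dominates C D) : D.length ≤ C.length := by
  have hD := countP_le_eq_length_of_forall_lt (v := D) (x := D.sum + 1)
    (fun a ha => Nat.lt_succ_of_le (List.single_le_sum (by simp) a ha)) le_rfl
  rw [← hD]
  exact (h _).trans List.countP_le_length

/-- `L` is the list of columns of a semistandard tableau, each read from bottom to top. -/
def IsColumnTableau : List (List ℕ) → Prop
  | [] => True
  | C :: L => C ≠ [] ∧ C.Pairwise (· > ·) ∧ Dominates C (L.headD []) ∧ IsColumnTableau L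

theorem exists_bump (x : ℕ) {C : List ℕ} (hC : C.Pairwise (· > ·)) :
    (∀ a ∈ C, a < x) ∨
      ∃ u c v, C = u ++ c :: v ∧ (∀ a ∈ u, c < a) ∧ x ≤ c ∧ ∀ a ∈ v, a < x := by
  induction C with
  | nil => simp
  | cons a C ih =>
    rw [List.pairwise_cons] at hC
    rcases lt_or_ge a x with hax | hxa
    · left
      intro b hb
      rcases List.mem_cons.1 hb with rfl | hb
      exacts [hax, (hC.1 b hb).trans hax]
    · right
      rcases ih hC.2 with h | ⟨u, c, v, rfl, hu, hxc, hv⟩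
      · exact ⟨[], a, C, rfl, by simp, hxa, h⟩
      · refine ⟨a :: u, c, v, rfl, ?_, hxc, hv⟩
        intro b hb
        rcases List.mem_cons.1 hb with rfl | hb
        exacts [hC.1 c (by simp), hu b hb]

theorem knuthEquiv_move_past_larger {x c : ℕ} (u w : List ℕ)
    (hu : (u ++ [c]).Pairwise (· > ·)) (hxc : x ≤ c) :
    KnuthEquiv (x :: (u ++ c :: w)) (u ++ x :: c :: w) := by
  induction u with
  | nil => exact KnuthEquiv.refl _
  | cons a u ih =>
    rw [List.cons_append, List.pairwise_cons] at hu
    have hle : ∀ b ∈ u ++ [c], x ≤ b := by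
      intro b hb
      rcases List.mem_append.1 hb with hb | hb
      · exact hxc.trans ((List.pairwise_append.1 hu.2).2.2 b hb c (by simp)).le
      · rw [List.mem_singleton.1 hb]
        exact hxc
    refine KnuthEquiv.trans ?_ ((ih hu.2).append_left [a])
    refine Relation.EqvGen.symm _ _ (Relation.EqvGen.rel _ _ ?_)
    cases u with
    | nil =>
      exact KnuthMove.right [] w x c a hxc (hu.1 c (by simp))
    | cons b u =>
      exact KnuthMove.right [] (u ++ c :: w) x b a (hle b (by simp)) (hu.1 b (by simp))

theorem knuthEquiv_move_past_smaller {y c : ℕ} (v : List ℕ) (hv : (y :: v).Pairwise (· > ·))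
    (hyc : y ≤ c) : KnuthEquiv (y :: c :: v) (y :: (v ++ [c])) := by
  induction v generalizing y with
  | nil => exact KnuthEquiv.refl _
  | cons a v ih =>
    rw [List.pairwise_cons] at hv
    have hay : a < y := hv.1 a (by simp)
    refine KnuthEquiv.trans (Relation.EqvGen.rel _ _ (KnuthMove.left [] v a y c hay hyc)) ?_
    exact (ih hv.2 (hay.le.trans hyc)).append_left [y]

theorem exists_columnInsert (L : List (List ℕ)) (hL : IsColumnTableau L) (x : ℕ) :
    ∃ L', IsColumnTableau L' ∧ KnuthEquiv (x :: L.flatten) L'.flatten ∧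
      ∀ B, Dominates B (L.headD []) →
        (∀ t, x ≤ t → (L.headD []).countP (· < x) + 1 ≤ B.countP (· ≤ t)) →
        Dominates B (L'.headD []) := by
  induction L generalizing x with
  | nil =>
    refine ⟨[[x]], ⟨by simp, by simp, by simp [Dominates], trivial⟩, KnuthEquiv.refl _, ?_⟩
    intro B _ hB t
    by_cases hxt : x ≤ t
    · simpa [hxt] using hB t hxt
    · simp [hxt]
  | cons C L ih =>
    obtain ⟨hne, hC, hdom, hL⟩ := hL
    rcases exists_bump x hC with hlt | ⟨u, c, v, rfl, hu, hxc, hv⟩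
    · refine ⟨(x :: C) :: L, ⟨by simp, List.pairwise_cons.2 ⟨hlt, hC⟩, fun t => ?_, hL⟩,
        KnuthEquiv.refl _, fun B hB hB' t => ?_⟩
      · rw [List.countP_cons]
        exact (hdom t).trans (Nat.le_add_right _ _)
      · simp only [List.headD_cons, List.countP_cons, decide_eq_true_eq] at hB' ⊢
        by_cases hxt : x ≤ t
        · have := hB' t hxt
          rw [countP_lt_eq_length_of_forall_lt hlt le_rfl] at this
          rw [if_pos hxt, countP_le_eq_length_of_forall_lt hlt hxt]
          exact this
        · rw [if_neg hxt]
          exact hB t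
    · obtain ⟨L', hL', hknuth, hhead⟩ := ih hL c
      have hpu := List.pairwise_append.1 hC
      have hpv := List.pairwise_cons.1 hpu.2.1
      have hC' : (u ++ x :: v).Pairwise (· > ·) := by
        refine List.pairwise_append.2 ⟨hpu.1, List.pairwise_cons.2 ⟨hv, hpv.2⟩, ?_⟩
        intro a ha b hb
        rcases List.mem_cons.1 hb with rfl | hb
        exacts [hxc.trans_lt (hu a ha), (hv b hb).trans_le (hxc.trans (hu a ha).le)]
      refine ⟨(u ++ x :: v) :: L', ⟨by simp, hC', ?_, hL'⟩, ?_, ?_⟩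
      · refine hhead _ (fun t => (hdom t).trans ?_) (fun t hct => ?_)
        · simp only [List.countP_append, List.countP_cons, decide_eq_true_eq]
          split_ifs <;> omega
        · have h1 := hdom.countP_lt_le c
          have h2 : u.countP (· < c) = 0 :=
            List.countP_eq_zero.2 fun a ha => by simpa using (hu a ha).le
          have h3 : v.countP (· < c) ≤ v.length := List.countP_le_length
          have h4 := countP_le_eq_length_of_forall_lt hv (hxc.trans hct)
          simp only [List.countP_append, List.countP_cons, decide_eq_true_eq] at h1 ⊢
          rw [if_neg (lt_irrefl c)] at h1
          rw [if_pos (hxc.trans hct)]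
          omega
      · have h1 : KnuthEquiv (x :: (u ++ c :: v)) (u ++ (x :: (v ++ [c]))) := by
          refine (knuthEquiv_move_past_larger u v ?_ hxc).trans ?_
          · exact hC.sublist (List.Sublist.append_left (by simp) u)
          · exact (knuthEquiv_move_past_smaller v (List.pairwise_append.1 hC').2.1 hxc).append_left u
        have h2 := h1.append_right L.flatten
        have h3 := hknuth.append_left (u ++ x :: v)
        simp only [List.flatten_cons, List.append_assoc, List.cons_append, List.nil_append]
          at h2 h3 ⊢
        exact h2.trans h3
      · intro B hB hB' t
        have h1 := hB t
        simp only [List.headD_cons, List.countP_append, List.countP_cons, decide_eq_true_eq]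
          at h1 hB' ⊢
        by_cases hxt : x ≤ t
        · by_cases hct : c ≤ t
          · rw [if_pos hxt]
            rw [if_pos hct] at h1
            exact h1
          · have h2 := hB' t hxt
            have h3 : u.countP (· ≤ t) = 0 :=
              List.countP_eq_zero.2 fun a ha => by
                have := hu a ha
                simp only [decide_eq_true_eq]
                omega
            have h4 : v.countP (· ≤ t) ≤ v.length := List.countP_le_length
            rw [countP_lt_eq_length_of_forall_lt hv le_rfl] at h2
            rw [if_pos hxt]
            omega
        · rw [if_neg hxt]
          omega

theorem exists_isColumnTableau_knuthEquiv (w : List ℕ) :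
    ∃ L, IsColumnTableau L ∧ KnuthEquiv w L.flatten := by
  induction w with
  | nil => exact ⟨[], trivial, KnuthEquiv.refl _⟩
  | cons x w ih =>
    obtain ⟨L, hL, hw⟩ := ih
    obtain ⟨L', hL', hw', -⟩ := exists_columnInsert L hL x
    exact ⟨L', hL', (hw.append_left [x]).trans hw'⟩

/-! ### Tableaux from lists of columns -/

theorem IsColumnTableau.pairwise {L : List (List ℕ)} (hL : IsColumnTableau L) (j : ℕ) :
    (L.getD j []).Pairwise (· > ·) := by
  induction L generalizing j with
  | nil => simp
  | cons C L ih =>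
    cases j with
    | zero => exact hL.2.1
    | succ j => exact ih hL.2.2.2 j

theorem IsColumnTableau.length_pos_iff {L : List (List ℕ)} (hL : IsColumnTableau L) (j : ℕ) :
    0 < (L.getD j []).length ↔ j < L.length := by
  induction L generalizing j with
  | nil => simp
  | cons C L ih =>
    cases j with
    | zero => simpa [List.length_pos_iff] using hL.1
    | succ j => simpa using ih hL.2.2.2 j

theorem IsColumnTableau.dominates_succ {L : List (List ℕ)} (hL : IsColumnTableau L) (j : ℕ) :
    Dominates (L.getD j []) (L.getD (j + 1) []) := by
  induction L generalizing j with
  | nil => simp [Dominates]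
  | cons C L ih =>
    cases j with
    | zero =>
      have := hL.2.2.1
      cases L <;> exact this
    | succ j => exact ih hL.2.2.2 j

theorem IsColumnTableau.dominates {L : List (List ℕ)} (hL : IsColumnTableau L) {j j' : ℕ}
    (h : j ≤ j') : Dominates (L.getD j []) (L.getD j' []) := by
  induction h with
  | refl => exact fun _ => le_rfl
  | step _ ih => exact ih.trans (hL.dominates_succ _)

theorem getD_le_iff_lt_countP {l : List ℕ} (hl : l.Pairwise (· < ·)) {i : ℕ}
    (hi : i < l.length) (t : ℕ) : l.getD i 0 ≤ t ↔ i < l.countP (· ≤ t) := by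
  induction l generalizing i with
  | nil => simp at hi
  | cons a l ih =>
    rw [List.pairwise_cons] at hl
    by_cases hat : a ≤ t
    · cases i with
      | zero => simp [hat]
      | succ i => simpa [hat] using ih hl.2 (Nat.lt_of_succ_lt_succ hi)
    · have h0 : (a :: l).countP (· ≤ t) = 0 :=
        List.countP_eq_zero.2 fun b hb => by
          rcases List.mem_cons.1 hb with rfl | hb
          · simpa using hat
          · have := hl.1 b hb
            simp only [decide_eq_true_eq]
            omega
      rw [h0]
      simp only [not_lt_zero, iff_false, not_le]
      have hmem : (a :: l).getD i 0 ∈ a :: l := by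
        rw [List.getD_eq_getElem _ _ hi]
        exact List.getElem_mem hi
      rcases List.mem_cons.1 hmem with h | h
      · omega
      · have := hl.1 _ h
        omega

theorem map_range_getD {α : Type*} (l : List α) (d : α) :
    (List.range l.length).map (fun i => l.getD i d) = l := by
  refine List.ext_getElem (by simp) fun i h1 h2 => ?_
  rw [List.getElem_map, List.getElem_range, List.getD_eq_getElem _ _ h2]

/-- The Young diagram whose column lengths are the lengths of the lists in `L`. -/
def columnDiagram (L : List (List ℕ)) (hL : IsColumnTableau L) : YoungDiagram where
  cells := ((Finset.range (L.getD 0 []).length) ×ˢ (Finset.range L.length)).filter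
    fun p => p.1 < (L.getD p.2 []).length
  isLowerSet := by
    rintro ⟨a, b⟩ ⟨c, d⟩ hle hmem
    have hca : c ≤ a := hle.1
    have hdb : d ≤ b := hle.2
    have := (hL.dominates hdb).length_le
    simp only [Finset.coe_filter, Finset.mem_product, Finset.mem_range, Set.mem_ofPred_eq]
      at hmem ⊢
    omega

theorem mem_columnDiagram {L : List (List ℕ)} (hL : IsColumnTableau L) {i j : ℕ} :
    (i, j) ∈ columnDiagram L hL ↔ i < (L.getD j []).length := by
  rw [← YoungDiagram.mem_cells]
  simp only [columnDiagram, Finset.mem_filter, Finset.mem_product, Finset.mem_range]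
  constructor
  · exact fun h => h.2
  · intro h
    exact ⟨⟨h.trans_le (hL.dominates (Nat.zero_le j)).length_le,
      (hL.length_pos_iff j).1 (Nat.zero_lt_of_lt h)⟩, h⟩

/-- The semistandard tableau with columns `L`. -/
def columnSSYT (L : List (List ℕ)) (hL : IsColumnTableau L) :
    SemistandardYoungTableau (columnDiagram L hL) where
  entry i j := (L.getD j []).reverse.getD i 0
  row_weak' := by
    intro i j1 j2 hj hcell
    rw [mem_columnDiagram] at hcell
    have hdom := hL.dominates hj.le
    have hi1 : i < (L.getD j1 []).length := hcell.trans_le hdom.length_le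
    rw [getD_le_iff_lt_countP (List.pairwise_reverse.2 (hL.pairwise j1)) (by simpa using hi1),
      List.countP_reverse]
    refine lt_of_lt_of_le ?_ (hdom _)
    rw [← List.countP_reverse,
      ← getD_le_iff_lt_countP (List.pairwise_reverse.2 (hL.pairwise j2)) (by simpa using hcell)]
  col_strict' := by
    intro i1 i2 j hi hcell
    rw [mem_columnDiagram] at hcell
    have h2 : i2 < (L.getD j []).reverse.length := by simpa using hcell
    rw [List.getD_eq_getElem _ _ h2, List.getD_eq_getElem _ _ (hi.trans h2)]
    exact List.pairwise_iff_getElem.1 (List.pairwise_reverse.2 (hL.pairwise j)) _ _ _ _ hi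
  zeros' := by
    intro i j hcell
    rw [mem_columnDiagram, not_lt] at hcell
    exact List.getD_eq_default _ _ (by simpa using hcell)

theorem readingWord_columnSSYT {L : List (List ℕ)} (hL : IsColumnTableau L) :
    readingWord (columnSSYT L hL) = L.flatten := by
  have hcol (j : ℕ) : (columnDiagram L hL).colLen j = (L.getD j []).length :=
    eq_of_forall_lt_iff fun i => by
      rw [← YoungDiagram.mem_iff_lt_colLen, mem_columnDiagram]
  have hrow : (columnDiagram L hL).rowLen 0 = L.length :=
    eq_of_forall_lt_iff fun j => by
      rw [← YoungDiagram.mem_iff_lt_rowLen, mem_columnDiagram, hL.length_pos_iff]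
  have hword (j : ℕ) : ((List.range ((columnDiagram L hL).colLen j)).reverse.map
      fun i => columnSSYT L hL i j) = L.getD j [] := by
    rw [List.map_reverse, hcol, ← List.length_reverse (as := L.getD j [])]
    refine (congrArg List.reverse (map_range_getD (L.getD j []).reverse 0)).trans ?_
    rw [List.reverse_reverse]
  rw [readingWord, hrow, List.flatMap_def, List.map_congr_left fun j _ => hword j,
    map_range_getD]

theorem exists_knuthEquiv_readingWord (w : List ℕ) :
    ∃ T : Tableau, KnuthEquiv w (readingWord T.2) := by
  obtain ⟨L, hL, hw⟩ := exists_isColumnTableau_knuthEquiv w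
  exact ⟨⟨_, columnSSYT L hL⟩, by rwa [readingWord_columnSSYT hL]⟩

theorem knuthEquiv_knuthTableau (w : List ℕ) :
    KnuthEquiv w (readingWord (knuthTableau w).2) := by
  rw [knuthTableau, dif_pos (exists_knuthEquiv_readingWord w)]
  exact (exists_knuthEquiv_readingWord w).choose_spec

/-! ### Highest-weight tableaux -/

theorem mem_readingWord {μ : YoungDiagram} {T : SemistandardYoungTableau μ} {a : ℕ} :
    a ∈ readingWord T ↔ ∃ i j, (i, j) ∈ μ ∧ T i j = a := by
  simp only [readingWord, List.mem_flatMap, List.mem_map, List.mem_reverse, List.mem_range,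
    ← YoungDiagram.mem_iff_lt_rowLen, ← YoungDiagram.mem_iff_lt_colLen]
  constructor
  · rintro ⟨j, -, i, hij, rfl⟩
    exact ⟨i, j, hij, rfl⟩
  · rintro ⟨i, j, hij, rfl⟩
    exact ⟨j, μ.up_left_mem (Nat.zero_le i) le_rfl hij, i, hij, rfl⟩

theorem exists_readingWord_eq_append_cons {μ : YoungDiagram} (T : SemistandardYoungTableau μ)
    {i j : ℕ} (hij : (i, j) ∈ μ) :
    ∃ u v, readingWord T = u ++ T i j :: v ∧
      ∀ a ∈ v, ∃ p q, (p, q) ∈ μ ∧ T p q = a ∧ (j < q ∨ p < i) := by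
  have hj : j ∈ List.range (μ.rowLen 0) := by
    rw [List.mem_range, ← YoungDiagram.mem_iff_lt_rowLen]
    exact μ.up_left_mem (Nat.zero_le i) le_rfl hij
  have hi : i ∈ (List.range (μ.colLen j)).reverse := by
    rwa [List.mem_reverse, List.mem_range, ← YoungDiagram.mem_iff_lt_colLen]
  obtain ⟨s, t, hst⟩ := List.append_of_mem hj
  obtain ⟨s', t', hst'⟩ := List.append_of_mem hi
  refine ⟨_, _, by
    rw [readingWord, hst, List.flatMap_append, List.flatMap_cons, hst', List.map_append,
      List.map_cons, List.append_assoc, List.cons_append, ← List.append_assoc], ?_⟩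
  intro a ha
  rcases List.mem_append.1 ha with ha | ha
  · obtain ⟨p, hp, rfl⟩ := List.mem_map.1 ha
    have hpw : (s' ++ i :: t').Pairwise (· > ·) := by
      rw [← hst', List.pairwise_reverse]
      exact List.pairwise_lt_range
    have hpi : p < i := (List.pairwise_cons.1 (List.pairwise_append.1 hpw).2.1).1 p hp
    exact ⟨p, j, μ.up_left_mem hpi.le le_rfl hij, rfl, Or.inr hpi⟩
  · obtain ⟨q, hq, ha⟩ := List.mem_flatMap.1 ha
    obtain ⟨p, hp, rfl⟩ := List.mem_map.1 ha
    rw [List.mem_reverse, List.mem_range, ← YoungDiagram.mem_iff_lt_colLen] at hp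
    have hpw : (s ++ j :: t).Pairwise (· < ·) := by
      rw [← hst]
      exact List.pairwise_lt_range
    exact ⟨p, q, hp, rfl,
      Or.inl ((List.pairwise_cons.1 (List.pairwise_append.1 hpw).2.1).1 q hq)⟩

theorem IsReverseLattice.mem_of_succ_cons {x : ℕ} {v : List ℕ}
    (h : IsReverseLattice x ((x + 1) :: v)) : x ∈ v := by
  have h1 := h.count_le
  rw [List.count_cons_self, List.count_cons_of_ne (by omega)] at h1
  exact List.count_pos_iff.1 (by omega)

theorem apply_eq_of_isReverseLattice {μ : YoungDiagram} (T : SemistandardYoungTableau μ) {b : ℕ}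
    (hb : ∀ a ∈ readingWord T, b ≤ a)
    (hT : ∀ x, b ≤ x → x + 1 ∈ readingWord T → IsReverseLattice x (readingWord T))
    {i j : ℕ} (hij : (i, j) ∈ μ) : T i j = b + i := by
  induction i using Nat.strong_induction_on generalizing j with
  | _ i ih =>
    refine le_antisymm ?_ ?_
    · by_contra! hlt
      obtain ⟨x, hx⟩ : ∃ x, T i j = x + 1 := ⟨T i j - 1, by omega⟩
      obtain ⟨u, v, huv, hv⟩ := exists_readingWord_eq_append_cons T hij
      have hlat := hT x (by omega) (hx ▸ mem_readingWord.2 ⟨i, j, hij, rfl⟩)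
      rw [huv, hx] at hlat
      obtain ⟨p, q, hpq, hxpq, hcase⟩ := hv x hlat.of_append.mem_of_succ_cons
      rcases lt_or_ge p i with hpi | hip
      · have := ih p hpi hpq
        omega
      · have hjq : j < q := by omega
        have h1 := T.row_weak hjq (μ.up_left_mem hip le_rfl hpq)
        have h2 := T.col_weak hip hpq
        omega
    · cases i with
      | zero => exact hb _ (mem_readingWord.2 ⟨0, j, hij, rfl⟩)
      | succ i =>
        have h1 := ih i (Nat.lt_succ_self i) (μ.up_left_mem (Nat.le_succ i) le_rfl hij)
        have h2 : T i j < T (i + 1) j := T.col_strict (Nat.lt_succ_self i) hij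
        omega

theorem highestWeightTableau_apply {μ : YoungDiagram} (b : ℕ) {i j : ℕ} (hij : (i, j) ∈ μ) :
    highestWeightTableau μ b i j = b + i :=
  if_pos hij

theorem eq_highestWeightTableau {μ : YoungDiagram} (T : SemistandardYoungTableau μ) {b : ℕ}
    (hb : ∀ a ∈ readingWord T, b ≤ a)
    (hT : ∀ x, b ≤ x → x + 1 ∈ readingWord T → IsReverseLattice x (readingWord T)) :
    T = highestWeightTableau μ b := by
  ext i j
  by_cases hij : (i, j) ∈ μ
  · rw [highestWeightTableau_apply b hij, apply_eq_of_isReverseLattice T hb hT hij]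
  · rw [T.zeros hij, SemistandardYoungTableau.zeros _ hij]

theorem readingWord_highestWeightTableau (μ : YoungDiagram) (b : ℕ) :
    readingWord (highestWeightTableau μ b) =
      (List.range (μ.rowLen 0)).flatMap fun j =>
        (List.range (μ.colLen j)).reverse.map fun i => b + i := by
  rw [readingWord]
  congr 1
  funext j
  refine List.map_congr_left fun i hi => highestWeightTableau_apply b ?_
  rwa [List.mem_reverse, List.mem_range, ← YoungDiagram.mem_iff_lt_colLen] at hi

theorem count_map_add_range (b c i : ℕ) :
    (((List.range c).reverse.map fun i => b + i).count (b + i)) = if i < c then 1 else 0 := by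
  rw [List.count_map_of_injective _ (fun i => b + i) (add_right_injective b), List.count_reverse]
  split_ifs with h
  · exact List.count_eq_one_of_mem List.nodup_range (List.mem_range.2 h)
  · exact List.count_eq_zero_of_not_mem (by simpa using h)

theorem isReverseLattice_map_add_range {b x : ℕ} (c : ℕ) (hx : b ≤ x) :
    IsReverseLattice x ((List.range c).reverse.map fun i => b + i) := by
  induction c with
  | zero => exact isReverseLattice_nil x
  | succ c ih =>
    have h : ((List.range (c + 1)).reverse.map fun i => b + i) =
        (b + c) :: (List.range c).reverse.map fun i => b + i := by
      simp [List.range_succ]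
    rw [h, isReverseLattice_cons, ← h]
    refine ⟨?_, ih⟩
    obtain ⟨i, rfl⟩ := Nat.exists_eq_add_of_le hx
    rw [add_assoc, count_map_add_range, count_map_add_range]
    split_ifs <;> omega

theorem isReverseLattice_highestWeightTableau (μ : YoungDiagram) {b x : ℕ} (hx : b ≤ x) :
    IsReverseLattice x (readingWord (highestWeightTableau μ b)) := by
  rw [readingWord_highestWeightTableau]
  induction List.range (μ.rowLen 0) with
  | nil => exact isReverseLattice_nil x
  | cons j l ih =>
    rw [List.flatMap_cons]
    exact (isReverseLattice_map_add_range _ hx).append ih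

theorem count_readingWord_highestWeightTableau (μ : YoungDiagram) (b i : ℕ) :
    (readingWord (highestWeightTableau μ b)).count (b + i) = μ.rowLen i := by
  have hle : μ.rowLen i ≤ μ.rowLen 0 := μ.rowLen_anti 0 i (Nat.zero_le i)
  rw [readingWord_highestWeightTableau, List.count_flatMap,
    List.map_congr_left (g := fun j => if j < μ.rowLen i then 1 else 0) fun j _ => by
      simp only [Function.comp_apply, count_map_add_range, ← YoungDiagram.mem_iff_lt_colLen,
        ← YoungDiagram.mem_iff_lt_rowLen]]
  change ∑ j ∈ Finset.range (μ.rowLen 0), (if j < μ.rowLen i then 1 else 0) = μ.rowLen i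
  rw [← Finset.sum_filter, Finset.sum_const, smul_eq_mul, mul_one,
    show (Finset.range (μ.rowLen 0)).filter (· < μ.rowLen i) = Finset.range (μ.rowLen i) by
      ext j
      simp only [Finset.mem_filter, Finset.mem_range]
      omega, Finset.card_range]

theorem rowLen_eq_zero_of_colLen_le {μ : YoungDiagram} {i : ℕ} (h : μ.colLen 0 ≤ i) :
    μ.rowLen i = 0 := by
  by_contra hne
  have := YoungDiagram.mem_iff_lt_rowLen.2 (Nat.pos_of_ne_zero hne)
  rw [YoungDiagram.mem_iff_lt_colLen] at this
  omega

theorem youngDiagram_eq_of_rowLen_eq {μ ν : YoungDiagram} (h : ∀ i, μ.rowLen i = ν.rowLen i) :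
    μ = ν := by
  ext ⟨i, j⟩
  rw [YoungDiagram.mem_cells, YoungDiagram.mem_cells, YoungDiagram.mem_iff_lt_rowLen, h,
    YoungDiagram.mem_iff_lt_rowLen]

theorem knuthTableau_eq_highestWeightTableau_iff {w : List ℕ} {b l : ℕ} {lam : YoungDiagram}
    (hlam : lam.colLen 0 ≤ l) (hw : ∀ a ∈ w, b ≤ a ∧ a < b + l) :
    knuthTableau w = ⟨lam, highestWeightTableau lam b⟩ ↔
      (∀ x, b ≤ x → x + 1 < b + l → IsReverseLattice x w) ∧
        ∀ i < l, w.count (b + i) = lam.rowLen i := by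
  have hequiv := knuthEquiv_knuthTableau w
  constructor
  · intro h
    rw [h] at hequiv
    refine ⟨fun x hx _ => (hequiv.isReverseLattice_iff x).2
      (isReverseLattice_highestWeightTableau lam hx), fun i _ => ?_⟩
    rw [hequiv.perm.count_eq, count_readingWord_highestWeightTableau]
  · rintro ⟨hlat, hcount⟩
    generalize knuthTableau w = S at hequiv ⊢
    obtain ⟨μ, T⟩ := S
    have hmem : ∀ a ∈ readingWord T, b ≤ a ∧ a < b + l :=
      fun a ha => hw a (hequiv.perm.mem_iff.2 ha)
    obtain rfl : T = highestWeightTableau μ b :=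
      eq_highestWeightTableau T (fun a ha => (hmem a ha).1) fun x hx hx' =>
        (hequiv.isReverseLattice_iff x).1 (hlat x hx (hmem _ hx').2)
    obtain rfl : μ = lam := youngDiagram_eq_of_rowLen_eq fun i => by
      rw [← count_readingWord_highestWeightTableau μ b, ← hequiv.perm.count_eq]
      rcases lt_or_ge i l with hi | hi
      · exact hcount i hi
      · rw [rowLen_eq_zero_of_colLen_le (hlam.trans hi)]
        refine List.count_eq_zero_of_not_mem fun h => ?_
        have := hw _ h
        omega
    rfl

/-! ### Reverse lattice row words and the polytope -/

theorem isReverseLattice_filter {x : ℕ} {p : ℕ → Bool} (hx : p x) (hx' : p (x + 1))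
    (w : List ℕ) : IsReverseLattice x (w.filter p) ↔ IsReverseLattice x w := by
  induction w with
  | nil => rfl
  | cons a w ih =>
    by_cases ha : p a
    · rw [List.filter_cons_of_pos ha, isReverseLattice_cons, isReverseLattice_cons, ih,
        ← List.filter_cons_of_pos ha, List.count_filter hx, List.count_filter hx']
    · rw [List.filter_cons_of_neg ha, isReverseLattice_cons, ih,
        List.count_cons_of_ne (by rintro rfl; exact ha hx'),
        List.count_cons_of_ne (by rintro rfl; exact ha hx)]
      exact ⟨fun h => ⟨h.count_le, h⟩, fun h => h.2⟩

theorem isReverseLattice_sorted_append {x : ℕ} {u : List ℕ} (hu : u.Pairwise (· ≤ ·))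
    (w : List ℕ) :
    IsReverseLattice x (u ++ w) ↔
      IsReverseLattice x w ∧ u.count (x + 1) + w.count (x + 1) ≤ w.count x := by
  induction u with
  | nil => simpa using fun h : IsReverseLattice x w => h.count_le
  | cons a u ih =>
    rw [List.pairwise_cons] at hu
    rw [List.cons_append, isReverseLattice_cons, ih hu.2]
    simp only [List.count_cons, List.count_append, beq_iff_eq]
    by_cases hax : a = x + 1
    · have h0 : u.count x = 0 := List.count_eq_zero_of_not_mem fun h => by
        have := hu.1 x h
        omega
      rw [if_pos hax, if_neg (by omega), h0]
      constructor
      · rintro ⟨h1, h2, h3⟩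
        exact ⟨h2, by omega⟩
      · rintro ⟨h1, h2⟩
        exact ⟨by omega, h1, by omega⟩
    · rw [if_neg hax]
      constructor
      · rintro ⟨h1, h2, h3⟩
        exact ⟨h2, by omega⟩
      · rintro ⟨h1, h2⟩
        exact ⟨by omega, h1, by omega⟩

theorem count_flatMap_finRange {n : ℕ} (col : Fin n → List ℕ) (a : ℕ) :
    ((List.finRange n).flatMap col).count a = ∑ k, (col k).count a := by
  rw [List.count_flatMap, Fin.sum_univ_def]
  rfl

theorem isReverseLattice_flatMap_iff (x : ℕ) {n : ℕ} (col : Fin n → List ℕ)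
    (hcol : ∀ k, (col k).Pairwise (· ≤ ·)) :
    IsReverseLattice x ((List.finRange n).flatMap col) ↔
      ∀ j : Fin n, (∑ k : Fin n, if j ≤ k then (col k).count (x + 1) else 0) ≤
        ∑ k : Fin n, if j < k then (col k).count x else 0 := by
  induction n with
  | zero => simpa using isReverseLattice_nil x
  | succ n ih =>
    rw [List.finRange_succ, List.flatMap_cons, List.flatMap_map,
      isReverseLattice_sorted_append (hcol 0), ih _ fun k => hcol k.succ,
      count_flatMap_finRange, count_flatMap_finRange, Fin.forall_fin_succ, and_comm]
    simp [Fin.sum_univ_succ]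

theorem rowWord_eq {m n : ℕ} (A : Matrix (Fin m) (Fin n) ℕ) :
    rowWord A = (List.finRange n).flatMap fun j =>
      (List.finRange m).flatMap fun i => List.replicate (A i j) (i.val + 1) := by
  simp only [rowWord, rowCells, List.map_flatMap, List.map_replicate]

theorem colWord_eq_rowWord_transpose {m n : ℕ} (A : Matrix (Fin m) (Fin n) ℕ) :
    colWord A = rowWord A.transpose := by
  simp only [rowWord_eq, colWord, colCells, List.map_flatMap, List.map_replicate,
    Matrix.transpose_apply]

theorem count_columnWord {m : ℕ} (f : Fin m → ℕ) (i : Fin m) :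
    ((List.finRange m).flatMap fun i => List.replicate (f i) (i.val + 1)).count (i.val + 1) =
      f i := by
  rw [count_flatMap_finRange, Finset.sum_eq_single i]
  · simp
  · intro k _ hk
    rw [List.count_replicate, if_neg]
    simpa [Fin.ext_iff] using hk
  · simp

theorem count_rowWord {m n : ℕ} (A : Matrix (Fin m) (Fin n) ℕ) (i : Fin m) :
    (rowWord A).count (i.val + 1) = ∑ j, A i j := by
  rw [rowWord_eq, count_flatMap_finRange]
  exact Finset.sum_congr rfl fun j _ => count_columnWord (fun i => A i j) i

theorem pairwise_columnWord {m : ℕ} (f : Fin m → ℕ) :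
    ((List.finRange m).flatMap fun i => List.replicate (f i) (i.val + 1)).Pairwise (· ≤ ·) := by
  rw [List.pairwise_flatMap]
  refine ⟨fun i _ => List.pairwise_replicate.2 (Or.inr le_rfl),
    (List.pairwise_lt_finRange m).imp fun {i k} hik a ha b hb => ?_⟩
  rw [List.eq_of_mem_replicate ha, List.eq_of_mem_replicate hb]
  exact Nat.succ_le_succ (Fin.le_def.1 hik.le)

theorem isReverseLattice_rowWord_iff {m n : ℕ} (A : Matrix (Fin m) (Fin n) ℕ) {lo hi : Fin m}
    (h : hi.val = lo.val + 1) :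
    IsReverseLattice hi.val (rowWord A) ↔
      ∀ j : Fin n, (∑ k : Fin n, if j ≤ k then A hi k else 0) ≤
        ∑ k : Fin n, if j < k then A lo k else 0 := by
  rw [rowWord_eq, isReverseLattice_flatMap_iff _ _ fun j => pairwise_columnWord fun i => A i j]
  simp only [count_columnWord (fun i => A i _) hi]
  rw [h]
  simp only [count_columnWord (fun i => A i _) lo]

theorem sum_Icc_eq_sum_fin (g : ℕ → ℝ) (j n : ℕ) :
    ∑ k ∈ Finset.Icc (j + 1) n, g k = ∑ k : Fin n, if j ≤ k.val then g (k.val + 1) else 0 := by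
  rw [Fin.sum_univ_eq_sum_range (fun k => if j ≤ k then g (k + 1) else 0) n, ← Finset.sum_filter]
  refine Finset.sum_nbij' (fun k => k - 1) (fun k => k + 1) ?_ ?_ ?_ ?_ ?_
  · intro k hk
    simp only [Finset.mem_Icc, Finset.mem_filter, Finset.mem_range] at hk ⊢
    omega
  · intro k hk
    simp only [Finset.mem_Icc, Finset.mem_filter, Finset.mem_range] at hk ⊢
    omega
  · intro k hk
    simp only [Finset.mem_Icc] at hk
    omega
  · intro k _
    simp
  · intro k hk
    simp only [Finset.mem_Icc] at hk
    rw [Nat.sub_add_cancel (by omega)]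

theorem entry_succ {m n : ℕ} (M : Matrix (Fin m) (Fin n) ℝ) (i : Fin m) (j : Fin n) :
    entry M (i.val + 1) (j.val + 1) = M i j :=
  dif_pos ⟨⟨by omega, i.isLt⟩, ⟨by omega, j.isLt⟩⟩

theorem sum_entry_Icc {m n : ℕ} (M : Matrix (Fin m) (Fin n) ℝ) (i : Fin m) (j : ℕ) :
    ∑ k ∈ Finset.Icc (j + 1) n, entry M (i.val + 1) k =
      ∑ k : Fin n, if j ≤ k.val then M i k else 0 := by
  rw [sum_Icc_eq_sum_fin]
  simp only [entry_succ]

theorem sum_entry_Icc_shift {m n : ℕ} (M : Matrix (Fin m) (Fin n) ℝ) (i : Fin m) {j : ℕ}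
    (hj : j < n) :
    ∑ k ∈ Finset.Icc (j + 1) n, entry M (i.val + 1) (k + 1) =
      ∑ k : Fin n, if j < k.val then M i k else 0 := by
  have h := sum_entry_Icc M i (j + 1)
  simp only [Nat.succ_le_iff] at h
  have h0 : entry M (i.val + 1) (n + 1) = 0 := dif_neg (by omega)
  have hshift : ∑ k ∈ Finset.Icc (j + 1) n, entry M (i.val + 1) (k + 1) =
      ∑ k ∈ Finset.Icc (j + 1 + 1) (n + 1), entry M (i.val + 1) k := by
    rw [← Finset.image_add_right_Icc, Finset.sum_image (by simp)]
  rw [← h, hshift, Finset.sum_Icc_succ_top (by omega), h0, add_zero]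

/-- The inequalities of the polytope that involve the rows. -/
structure RowConditions {m n r : ℕ} (I : Fin (r + 1) → ℕ) (lam : Fin r → YoungDiagram)
    (M : Matrix (Fin m) (Fin n) ℝ) : Prop where
  row_highest : ∀ i ∈ Finset.Icc 1 m, i ∉ Set.range I → ∀ j ∈ Finset.Icc 1 n,
    ∑ k ∈ Finset.Icc j n, entry M (i + 1) k ≤ ∑ k ∈ Finset.Icc j n, entry M i (k + 1)
  row_sum : ∀ i : Fin m, ∑ j, M i j = (flatParts I lam i.val : ℝ)

theorem row_highest_iff {m n r : ℕ} {I : Fin (r + 1) → ℕ} (hI : IsCutSeq I m)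
    (A : Matrix (Fin m) (Fin n) ℕ) :
    (∀ i ∈ Finset.Icc 1 m, i ∉ Set.range I → ∀ j ∈ Finset.Icc 1 n,
      ∑ k ∈ Finset.Icc j n, entry (A.map fun a => (a : ℝ)) (i + 1) k ≤
        ∑ k ∈ Finset.Icc j n, entry (A.map fun a => (a : ℝ)) i (k + 1)) ↔
      ∀ x, 1 ≤ x → x < m → x ∉ Set.range I → IsReverseLattice x (rowWord A) := by
  have key : ∀ x (hx : x + 1 < m), (∀ j ∈ Finset.Icc 1 n,
      ∑ k ∈ Finset.Icc j n, entry (A.map fun a => (a : ℝ)) (x + 1 + 1) k ≤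
        ∑ k ∈ Finset.Icc j n, entry (A.map fun a => (a : ℝ)) (x + 1) (k + 1)) ↔
      IsReverseLattice (x + 1) (rowWord A) := by
    intro x hx
    have h1 := isReverseLattice_rowWord_iff A (lo := ⟨x, by omega⟩) (hi := ⟨x + 1, hx⟩) rfl
    rw [h1]
    have h2 : ∀ j : Fin n,
        (∑ k ∈ Finset.Icc (j.val + 1) n, entry (A.map fun a => (a : ℝ)) (x + 1 + 1) k ≤
          ∑ k ∈ Finset.Icc (j.val + 1) n, entry (A.map fun a => (a : ℝ)) (x + 1) (k + 1)) ↔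
        (∑ k : Fin n, if j ≤ k then A ⟨x + 1, hx⟩ k else 0) ≤
          ∑ k : Fin n, if j < k then A ⟨x, by omega⟩ k else 0 := by
      intro j
      rw [sum_entry_Icc _ (⟨x + 1, hx⟩ : Fin m), sum_entry_Icc_shift _ (⟨x, by omega⟩ : Fin m) j.isLt,
        ← Nat.cast_le (α := ℝ)]
      simp only [Nat.cast_sum, Nat.cast_ite, Nat.cast_zero, Matrix.map_apply, Fin.le_def,
        Fin.lt_def]
    constructor
    · intro h j
      exact (h2 j).1 (h _ (Finset.mem_Icc.2 ⟨by omega, j.isLt⟩))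
    · intro h j hj
      rw [Finset.mem_Icc] at hj
      obtain ⟨j, rfl⟩ := Nat.exists_eq_add_of_le' hj.1
      exact (h2 ⟨j, hj.2⟩).2 (h _)
  constructor
  · intro h x hx1 hxm hxI
    obtain ⟨x, rfl⟩ := Nat.exists_eq_add_of_le' hx1
    exact (key x hxm).1 (h _ (Finset.mem_Icc.2 ⟨hx1, hxm.le⟩) hxI)
  · intro h x hx hxI
    rw [Finset.mem_Icc] at hx
    obtain ⟨hx1, hxm⟩ := hx
    have hne : x ≠ m := fun he => hxI ⟨Fin.last r, by rw [hI.last, he]⟩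
    obtain ⟨x, rfl⟩ := Nat.exists_eq_add_of_le' hx1
    exact (key x (by omega)).2 (h _ hx1 (by omega) hxI)

/-! ### Blocks of a cut sequence -/

theorem IsCutSeq.exists_block {r m : ℕ} {I : Fin (r + 1) → ℕ} (hI : IsCutSeq I m) {i : ℕ}
    (hi : i < m) : ∃ k : Fin r, I k.castSucc ≤ i ∧ i < I k.succ := by
  by_contra! h
  have hle : ∀ k, I k ≤ i := Fin.induction (by simp [hI.zero]) h
  have := hle (Fin.last r)
  rw [hI.last] at this
  omega

theorem IsCutSeq.le_last {r m : ℕ} {I : Fin (r + 1) → ℕ} (hI : IsCutSeq I m) (k : Fin (r + 1)) :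
    I k ≤ m :=
  hI.last ▸ hI.strictMono.monotone (Fin.le_last k)

theorem IsCutSeq.notMem_range {r m : ℕ} {I : Fin (r + 1) → ℕ} (hI : IsCutSeq I m) {k : Fin r}
    {x : ℕ} (h1 : I k.castSucc < x) (h2 : x < I k.succ) : x ∉ Set.range I := by
  rintro ⟨l, rfl⟩
  rw [hI.strictMono.lt_iff_lt, Fin.lt_def] at h1 h2
  simp only [Fin.val_castSucc, Fin.val_succ] at h1 h2
  omega

theorem IsCutSeq.flatParts_eq {r m : ℕ} {I : Fin (r + 1) → ℕ} (hI : IsCutSeq I m)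
    (lam : Fin r → YoungDiagram) {k : Fin r} {i : ℕ} (h1 : I k.castSucc ≤ i) (h2 : i < I k.succ) :
    flatParts I lam i = (lam k).rowLen (i - I k.castSucc) := by
  rw [flatParts, Finset.sum_eq_single k, if_pos ⟨h1, h2⟩]
  · intro l _ hl
    rw [if_neg]
    rintro ⟨h3, h4⟩
    have h5 := hI.strictMono.lt_iff_lt.1 (h1.trans_lt h4)
    have h6 := hI.strictMono.lt_iff_lt.1 (h3.trans_lt h2)
    rw [Fin.lt_def] at h5 h6
    simp only [Fin.val_castSucc, Fin.val_succ] at h5 h6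
    exact hl (Fin.ext (by omega))
  · simp

theorem knuthTableau_filterWord_iff {m n r : ℕ} {I : Fin (r + 1) → ℕ} (hI : IsCutSeq I m)
    {lam : Fin r → YoungDiagram} (hlam : IsFilteredTuple I lam) (A : Matrix (Fin m) (Fin n) ℕ) :
    (fun k => knuthTableau (filterWord I (rowWord A) k)) = highestWeightTuple I lam ↔
      RowConditions I lam (A.map fun a => (a : ℝ)) := by
  have hblock : ∀ k : Fin r, I k.castSucc < I k.succ :=
    fun k => hI.strictMono (Fin.castSucc_lt_succ)
  have hkey : ∀ k : Fin r,
      knuthTableau (filterWord I (rowWord A) k) = highestWeightTuple I lam k ↔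
        (∀ x, I k.castSucc < x → x < I k.succ → IsReverseLattice x (rowWord A)) ∧
          ∀ i : Fin m, I k.castSucc ≤ i.val → i.val < I k.succ →
            ∑ j, A i j = flatParts I lam i.val := by
    intro k
    have hk := hblock k
    rw [highestWeightTuple, knuthTableau_eq_highestWeightTableau_iff (hlam k) fun a ha => by
      have := of_decide_eq_true (List.mem_filter.1 ha).2
      omega]
    refine and_congr ?_ ?_
    · refine forall_congr' fun x => ?_
      constructor
      · intro h h1 h2
        exact (isReverseLattice_filter (by simp; omega) (by simp; omega) _).1
          (h (by omega) (by omega))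
      · intro h h1 h2
        exact (isReverseLattice_filter (by simp; omega) (by simp; omega) _).2
          (h (by omega) (by omega))
    · have hcount : ∀ i : Fin m, I k.castSucc ≤ i.val → i.val < I k.succ →
          (filterWord I (rowWord A) k).count (i.val + 1) = ∑ j, A i j := by
        intro i h1 h2
        rw [filterWord, List.count_filter (by simp; omega), count_rowWord]
      constructor
      · intro h i h1 h2
        rw [← hcount i h1 h2, hI.flatParts_eq lam h1 h2, ← h _ (by omega)]
        congr 1
        omega
      · intro h i hi
        have hm := hI.le_last k.succ
        have h1 := h ⟨I k.castSucc + i, by omega⟩ (by simp) (by simp; omega)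
        rw [← hcount _ (by simp) (by simp; omega), hI.flatParts_eq (k := k) lam (by simp) (by simp; omega)]
          at h1
        rw [add_right_comm, h1, Nat.add_sub_cancel_left]
  rw [funext_iff, forall_congr' hkey]
  constructor
  · intro h
    refine ⟨(row_highest_iff hI A).2 fun x hx hxm hxI => ?_, fun i => ?_⟩
    · obtain ⟨k, hk1, hk2⟩ := hI.exists_block hxm
      exact (h k).1 x (lt_of_le_of_ne hk1 fun he => hxI ⟨_, he⟩) hk2
    · obtain ⟨k, hk1, hk2⟩ := hI.exists_block i.isLt
      rw [← (h k).2 i hk1 hk2]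
      simp
  · rintro ⟨h1, h2⟩ k
    refine ⟨fun x hx1 hx2 => ?_, fun i _ _ => ?_⟩
    · have := hI.le_last k.succ
      exact (row_highest_iff hI A).1 h1 x (by omega) (by omega) (hI.notMem_range hx1 hx2)
    · have := h2 i
      simp only [Matrix.map_apply] at this
      exact_mod_cast this

theorem entry_transpose {m n : ℕ} (M : Matrix (Fin m) (Fin n) ℝ) (i j : ℕ) :
    entry M.transpose i j = entry M j i := by
  by_cases h : (1 ≤ i ∧ i ≤ n) ∧ (1 ≤ j ∧ j ≤ m)
  · rw [entry, entry, dif_pos h, dif_pos h.symm, Matrix.transpose_apply]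
  · rw [entry, entry, dif_neg h, dif_neg fun h' => h h'.symm]

theorem memPolytope_iff {m n r s : ℕ} {I : Fin (r + 1) → ℕ} {J : Fin (s + 1) → ℕ}
    {lam : Fin r → YoungDiagram} {mu : Fin s → YoungDiagram} {M : Matrix (Fin m) (Fin n) ℝ} :
    MemPolytope I J lam mu M ↔
      RowConditions I lam M ∧ RowConditions J mu M.transpose ∧ ∀ i j, 0 ≤ M i j := by
  constructor
  · rintro ⟨h1, h2, h3, h4, h5⟩
    exact ⟨⟨h1, h3⟩, ⟨by simpa only [entry_transpose] using h2, h4⟩, h5⟩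
  · rintro ⟨⟨h1, h3⟩, ⟨h2, h4⟩, h5⟩
    exact ⟨h1, by simpa only [entry_transpose] using h2, h3, h4, h5⟩

theorem filterRSK_eq_highestWeight_iff {m n r s : ℕ} {I : Fin (r + 1) → ℕ} {J : Fin (s + 1) → ℕ}
    (hI : IsCutSeq I m) (hJ : IsCutSeq J n) {lam : Fin r → YoungDiagram}
    {mu : Fin s → YoungDiagram} (hlam : IsFilteredTuple I lam) (hmu : IsFilteredTuple J mu)
    (A : Matrix (Fin m) (Fin n) ℕ) :
    filterRSK I J A = (highestWeightTuple I lam, highestWeightTuple J mu) ↔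
      A.map (fun a => (a : ℝ)) ∈ polytope m n I J lam mu := by
  refine Iff.trans ?_ memPolytope_iff.symm
  rw [filterRSK, Prod.mk.injEq, colWord_eq_rowWord_transpose,
    knuthTableau_filterWord_iff hI hlam, knuthTableau_filterWord_iff hJ hmu,
    Matrix.transpose_map]
  refine and_congr_right fun _ => (and_iff_left fun i j => ?_).symm
  exact Nat.cast_nonneg (A i j)

theorem finite_setOf_map_mem_polytope {r s : ℕ} (m n : ℕ) (I : Fin (r + 1) → ℕ)
    (J : Fin (s + 1) → ℕ) (lam : Fin r → YoungDiagram) (mu : Fin s → YoungDiagram) :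
    {A : Matrix (Fin m) (Fin n) ℕ | A.map (fun a => (a : ℝ)) ∈ polytope m n I J lam mu}.Finite := by
  refine (Set.finite_Iic (fun (i : Fin m) (_ : Fin n) => flatParts I lam i.val)).subset ?_
  intro A hA i j
  have h : ∑ j, (A i j : ℝ) = (flatParts I lam i.val : ℝ) := MemPolytope.row_sum hA i
  have h' : ∑ j, A i j = flatParts I lam i.val := by exact_mod_cast h
  show A i j ≤ flatParts I lam i.val
  rw [← h']
  exact Finset.single_le_sum (f := fun j => A i j) (fun _ _ => Nat.zero_le _) (Finset.mem_univ j)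

end FilteredRSK

theorem proposition7 {m n r s : ℕ} (I : Fin (r + 1) → ℕ) (J : Fin (s + 1) → ℕ)
    (hI : FilteredRSK.IsCutSeq I m) (hJ : FilteredRSK.IsCutSeq J n)
    (X : Set (Matrix (Fin m) (Fin n) ℂ)) (ord : MonomialOrder (Fin m × Fin n))
    (hX : FilteredRSK.IsBicrystallineWith I J ord X)
    (lam : Fin r → YoungDiagram) (mu : Fin s → YoungDiagram)
    (hlam : FilteredRSK.IsFilteredTuple I lam) (hmu : FilteredRSK.IsFilteredTuple J mu) :
    (FilteredRSK.highestWeightStd I J ord X lam mu).Finite ∧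
    (FilteredRSK.stdLatticePoints ord X ∩ FilteredRSK.polytope m n I J lam mu).Finite ∧
    FilteredRSK.coefficient I J ord X lam mu =
      (FilteredRSK.stdLatticePoints ord X ∩ FilteredRSK.polytope m n I J lam mu).ncard := by
  have hiff := FilteredRSK.filterRSK_eq_highestWeight_iff hI hJ hlam hmu
  have hfin : (FilteredRSK.highestWeightStd I J ord X lam mu).Finite :=
    (FilteredRSK.finite_setOf_map_mem_polytope m n I J lam mu).subset fun A hA => (hiff A).1 hA.2
  have himage : FilteredRSK.stdLatticePoints ord X ∩ FilteredRSK.polytope m n I J lam mu =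
      (fun A : Matrix (Fin m) (Fin n) ℕ => A.map fun a => (a : ℝ)) ''
        FilteredRSK.highestWeightStd I J ord X lam mu := by
    ext M
    constructor
    · rintro ⟨⟨A, hA, rfl⟩, hM⟩
      exact ⟨A, ⟨hA, (hiff A).2 hM⟩, rfl⟩
    · rintro ⟨A, ⟨hA, hA'⟩, rfl⟩
      exact ⟨⟨A, hA, rfl⟩, (hiff A).1 hA'⟩
  refine ⟨hfin, himage ▸ hfin.image _, ?_⟩
  rw [himage, Set.ncard_image_of_injective _ (Matrix.map_injective Nat.cast_injective)]
  rfl
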